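/- Write $\mathbb N=\{1,2,\dots\}$. For every countable limit ordinal $\eta$ fix a sequence of ordinals $(\eta_n)_{n\in\mathbb N}$ below $\eta$ with $\eta_n\nearrow\eta$. The Schreier families $\mathcal S_\xi$ ($\xi<\omega_1$) are the sets of finite subsets of $\mathbb N$ defined by $\mathcal S_0=\{\varnothing\}\cup\{\{n\}: n\in\mathbb N\}$, $\mathcal S_1=\{F:\#F\le\min F\}$ (including $\varnothing$), $\mathcal S_{\xi+1}=\mathcal S_1[\mathcal S_\xi]$, and $\mathcal S_\eta=\{F: n\le\min F\text{ and }F\in\mathcal S_{\eta_n}\text{ for some }n\in\mathbb N\}$ for limit $\eta$ (for $F=\varnothing$ the condition $n\le\min F$ is void). Here $\mathcal F[\mathcal G]$ is the set of unions $G_1\cup\dots\cup G_n$ of non-empty $G_i\in\mathcal G$ with $\max G_i<\min G_{i+1}$ and $\{\min G_1,\dots,\min G_n\}\in\mathcal F$, together with $\varnothing$ if $\varnothing\in\mathcal F$. Subspaces are closed linear subspaces, $[A]$ is the closed linear span of $A$, and a basic sequence $(x_n)_{n\in\mathbb N}$ is a sequence that is a Schauder basis of $[x_n]_{n\in\mathbb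 N}$. Let $1\le\xi<\omega_1$. * A Banach space $X$ is $\mathrm{HI}_\xi$ if for every $\varepsilon>0$, every infinite-dimensional subspace $Y\subseteq X$ and every basic sequence $(x_n)$ in $X$ there are $F\in\mathcal S_\xi$ and a unit vector $y\in Y$ with $\operatorname{dist}(y,[x_i]_{i\in F})<\varepsilon$. * A bounded operator $S:X_1\to X_2$ between Banach spaces is $\mathcal S_\xi$-strictly singular if for every $\varepsilon>0$ and every basic sequence $(x_n)$ in $X_1$ there are $F\in\mathcal S_\xi$ and $z\in[x_i]_{i\in F}\setminus\{0\}$ with $\|Sz\|\le\varepsilon\|z\|$. **Corollary.** Let $1\le\xi<\omega_1$, let $X$ be a complex $\mathrm{HI}_\xi$ Banach space, let $Y$ be an infinite-dimensional subspace of $X$, and let $T:Y\to X$ be a bounded linear operator. Then there exist $\lambda\in\mathbb C$ and an $\mathcal S_\xi$-strictly singular bounded linear operator $S:Y\to X$ such that $T=\lambda\, i_{Y,X}+S$, where $i_{Y,X}:Y\to X$ is the inclusion map. -/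

import Mathlib

/-! ### Schreier families

Finite sets of positive integers are modelled by `Finset ℕ+`. -/

/-- `𝓕[𝓖]`: all unions `G₁ ∪ ⋯ ∪ Gₙ` of non-empty sets `G₁ < ⋯ < Gₙ` from `𝓖` such that
`{min G₁, …, min Gₙ}` belongs to `𝓕`.  (The empty union occurs exactly when `∅ ∈ 𝓕`.) -/
def schreierConv (𝓕 𝓖 : Set (Finset ℕ+)) : Set (Finset ℕ+) :=
  {F | ∃ (n : ℕ) (G : Fin n → Finset ℕ+) (hG : ∀ i, (G i).Nonempty),
    (∀ i j, i < j → ∀ a ∈ G i, ∀ b ∈ G j, a < b) ∧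
    (∀ i, G i ∈ 𝓖) ∧
    (Finset.univ.image fun i => (G i).min' (hG i)) ∈ 𝓕 ∧
    F = Finset.univ.biUnion G}

/-- `𝓢₀`: the singletons and the empty set. -/
def schreierZero : Set (Finset ℕ+) :=
  {F | F = ∅ ∨ ∃ n, F = {n}}

/-- `𝓢₁`: the finite sets `F` with `#F ≤ min F` (the empty set included). -/
def schreierOne : Set (Finset ℕ+) :=
  {F | ∀ n ∈ F, F.card ≤ (n : ℕ)}

/-- A choice, for every countable limit ordinal `ξ`, of a sequence `c ξ 1 ≤ c ξ 2 ≤ ⋯` of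
ordinals below `ξ` with supremum `ξ`. -/
structure IsLadderSystem (c : Ordinal.{0} → ℕ+ → Ordinal.{0}) : Prop where
  monotone : ∀ ξ, Order.IsSuccLimit ξ → ξ < Ordinal.omega 1 → Monotone (c ξ)
  lt : ∀ ξ, Order.IsSuccLimit ξ → ξ < Ordinal.omega 1 → ∀ n, c ξ n < ξ
  cofinal : ∀ ξ, Order.IsSuccLimit ξ → ξ < Ordinal.omega 1 → ∀ β < ξ, ∃ n, β < c ξ n

/-- The Schreier family `𝓢_ξ`, built with the sequences `c η` at limit ordinals `η`:
`𝓢_{ξ+1} = 𝓢₁[𝓢_ξ]`, and at a limit `ξ` a set `F` belongs to `𝓢_ξ` when `n ≤ F` and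
`F ∈ 𝓢_{c ξ n}` for some `n`. -/
noncomputable def schreierFamily (c : Ordinal.{0} → ℕ+ → Ordinal.{0}) (ξ : Ordinal.{0}) :
    Set (Finset ℕ+) :=
  Ordinal.limitRecOn ξ schreierZero (fun _ 𝓖 => schreierConv schreierOne 𝓖)
    (fun η _ 𝓢 => {F | ∃ n : ℕ+, ∃ h : c η n < η, (∀ i ∈ F, n ≤ i) ∧ F ∈ 𝓢 (c η n) h})

theorem schreierFamily_zero (c : Ordinal.{0} → ℕ+ → Ordinal.{0}) :
    schreierFamily c 0 = schreierZero := by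
  simp [schreierFamily]

theorem schreierFamily_add_one (c : Ordinal.{0} → ℕ+ → Ordinal.{0}) (ξ : Ordinal.{0}) :
    schreierFamily c (ξ + 1) = schreierConv schreierOne (schreierFamily c ξ) := by
  simp [schreierFamily]

theorem schreierFamily_limit {c : Ordinal.{0} → ℕ+ → Ordinal.{0}} (hc : IsLadderSystem c)
    {ξ : Ordinal.{0}} (hξ : Order.IsSuccLimit ξ) (hξ' : ξ < Ordinal.omega 1) :
    schreierFamily c ξ = {F | ∃ n : ℕ+, (∀ i ∈ F, n ≤ i) ∧ F ∈ schreierFamily c (c ξ n)} := by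
  unfold schreierFamily
  rw [Ordinal.limitRecOn_limit _ _ _ _ hξ]
  ext F
  exact ⟨fun ⟨n, _, h⟩ => ⟨n, h⟩, fun ⟨n, h⟩ => ⟨n, hc.lt ξ hξ hξ' n, h⟩⟩

/-- The recursion gives `𝓢₁` its usual value. -/
theorem schreierFamily_one (c : Ordinal.{0} → ℕ+ → Ordinal.{0}) :
    schreierFamily c 1 = schreierOne := by
  rw [← zero_add (1 : Ordinal.{0}), schreierFamily_add_one, schreierFamily_zero]
  ext F
  constructor
  · rintro ⟨n, G, hG, -, hZ, hF, rfl⟩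
    have key : (Finset.univ.image fun i => (G i).min' (hG i)) = Finset.univ.biUnion G := by
      ext a
      simp only [Finset.mem_image, Finset.mem_univ, true_and, Finset.mem_biUnion]
      refine exists_congr fun i => ?_
      obtain h | ⟨m, hm⟩ := hZ i
      · exact absurd h (hG i).ne_empty
      · simp [hm, eq_comm]
    rwa [key] at hF
  · intro hF
    have key : (Finset.univ.image fun i => F.orderEmbOfFin rfl i) = F := by
      simp
    refine ⟨F.card, fun i => {F.orderEmbOfFin rfl i}, fun i => Finset.singleton_nonempty _,
      ?_, fun i => Or.inr ⟨_, rfl⟩, ?_, ?_⟩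
    · intro i j hij a ha b hb
      rw [Finset.mem_singleton] at ha hb
      subst ha hb
      exact (F.orderEmbOfFin rfl).strictMono hij
    · simpa only [Finset.min'_singleton, key] using hF
    · ext a
      rw [← Finset.ext_iff.1 key a, Finset.mem_image, Finset.mem_biUnion]
      simp only [Finset.mem_univ, true_and, Finset.mem_singleton]
      exact exists_congr fun i => eq_comm

/-! ### Basic sequences, `𝓢_ξ`-strictly singular operators and `HI_ξ` spaces -/

/-- `[A]`: the closed linear span of a set of vectors. -/
def closedSpan (𝕜 : Type*) {X : Type*} [RCLike 𝕜] [NormedAddCommGroup X] [NormedSpace 𝕜 X]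
    (A : Set X) : Submodule 𝕜 X :=
  (Submodule.span 𝕜 A).topologicalClosure

/-- `x₁, x₂, …` is a basic sequence: a Schauder basis of its closed linear span.
(Mathlib numbers the members of a Schauder basis from `0`.) -/
def IsBasicSequence (𝕜 : Type*) {X : Type*} [RCLike 𝕜] [NormedAddCommGroup X] [NormedSpace 𝕜 X]
    (x : ℕ+ → X) : Prop :=
  ∃ b : SchauderBasis 𝕜 (closedSpan 𝕜 (Set.range x)), ∀ n : ℕ, (b n : X) = x n.succPNat

/-- `T` is `𝓢_ξ`-strictly singular. -/
def IsSchreierStrictlySingular {𝕜 X₁ X₂ : Type*} [RCLike 𝕜]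
    [NormedAddCommGroup X₁] [NormedSpace 𝕜 X₁] [NormedAddCommGroup X₂] [NormedSpace 𝕜 X₂]
    (c : Ordinal.{0} → ℕ+ → Ordinal.{0}) (ξ : Ordinal.{0}) (T : X₁ →L[𝕜] X₂) : Prop :=
  ∀ ε : ℝ, 0 < ε → ∀ x : ℕ+ → X₁, IsBasicSequence 𝕜 x →
    ∃ F ∈ schreierFamily c ξ, ∃ z ∈ closedSpan 𝕜 (x '' (F : Set ℕ+)),
      z ≠ 0 ∧ ‖T z‖ ≤ ε * ‖z‖

/-- `X` is `𝓢_ξ`-hereditarily indecomposable (`HI_ξ`); subspaces are closed subspaces. -/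
def IsSchreierHI (𝕜 X : Type*) [RCLike 𝕜] [NormedAddCommGroup X] [NormedSpace 𝕜 X]
    (c : Ordinal.{0} → ℕ+ → Ordinal.{0}) (ξ : Ordinal.{0}) : Prop :=
  ∀ ε : ℝ, 0 < ε → ∀ Y : Submodule 𝕜 X, IsClosed (Y : Set X) → ¬ FiniteDimensional 𝕜 Y →
    ∀ x : ℕ+ → X, IsBasicSequence 𝕜 x →
      ∃ F ∈ schreierFamily c ξ, ∃ y ∈ Y,
        ‖y‖ = 1 ∧ Metric.infDist y (closedSpan 𝕜 (x '' (F : Set ℕ+)) : Set X) < ε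

/-!
The proof has two halves, Ferenczi's theorem on operators in hereditarily indecomposable (HI)
spaces and a short quantitative argument.

*From small to strictly singular.*  Suppose that for every `δ` the operator `S : Y → X` has norm at
most `δ` on some infinite-dimensional `W ⊆ Y`.  Given a basic sequence in `Y`, the `HI_ξ` property
applied to `W` produces `F ∈ 𝓢_ξ` and a unit vector `w ∈ W` close to `[x_i]_{i ∈ F}`; a nearby
vector of the span of the `x_i` witnesses that `S` is `𝓢_ξ`-strictly singular
(`IsSchreierHI.isSchreierStrictlySingular`).  So it suffices to find one scalar `μ` for which
`T - μ` is arbitrarily small on infinite-dimensional subspaces, and this is a statement about HI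
spaces, since `HI_ξ` implies HI by Mazur's theorem on basic sequences
(`exists_isBasicSequence_mem`).

*The scalar.*  A gliding-hump construction (`exists_isInfDimClosed_norm_le`) shows that an operator
which is not bounded below on any infinite-dimensional subspace is arbitrarily small on some such
subspace.  In an HI space this yields, for `T : Y → X` and any infinite-dimensional `Z`, a subspace
`W ⊆ Y` that `T` maps almost into `Z` (`IsHereditarilyIndecomposable.exists_norm_mkQL_le`); with
`T` the inclusion, any finitely many infinite-dimensional subspaces almost have one in common.

Call a bounded family of vectors, along a filter, *generic* if its distance to every
infinite-dimensional closed subspace tends to zero.  In an HI space there are generic families of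
unit vectors, operators `T : Y → X` map generic families to generic families, and up to null
families every generic family lies in `Y`.  Hence `T` induces an operator on the Banach space of
generic families modulo null families.  A boundary point `μ` of its spectrum is an approximate
eigenvalue (`exists_forall_norm_apply_sub_smul_lt`).  As generic families are asymptotically inside
every infinite-dimensional subspace, `T - μ` is not bounded below on any of them, and so it is
arbitrarily small on some.
-/

open Filter Topology

/-! ### Basic sequences -/

theorem range_comp_succPNat {α : Type*} (x : ℕ+ → α) :
    Set.range (fun n : ℕ => x n.succPNat) = Set.range x :=
  Equiv.pnatEquivNat.symm.surjective.range_comp x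

section BasicSequences

variable {𝕜 X : Type*} [RCLike 𝕜] [NormedAddCommGroup X] [NormedSpace 𝕜 X]

theorem linearCombination_eq_sum_range (u : ℕ → X) (l : ℕ →₀ 𝕜) {N : ℕ}
    (hN : l.support ⊆ Finset.range N) :
    Finsupp.linearCombination 𝕜 u l = ∑ i ∈ Finset.range N, l i • u i := by
  rw [Finsupp.linearCombination_apply, Finsupp.sum_of_support_subset _ hN _ (by simp)]

theorem exists_sum_range_of_mem_span {u : ℕ → X} {v : X}
    (hv : v ∈ Submodule.span 𝕜 (Set.range u)) :
    ∃ (a : ℕ → 𝕜) (N : ℕ), v = ∑ i ∈ Finset.range N, a i • u i := by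
  obtain ⟨l, rfl⟩ := Finsupp.mem_span_range_iff_exists_finsupp.1 hv
  obtain ⟨N, hN⟩ := l.support.exists_nat_subset_range
  exact ⟨l, N, linearCombination_eq_sum_range u l hN⟩

theorem linearIndependent_of_norm_sum_le {u : ℕ → X} {K : ℝ} (hu : ∀ n, u n ≠ 0)
    (hK : ∀ (a : ℕ → 𝕜) (m n : ℕ), m ≤ n →
      ‖∑ i ∈ Finset.range m, a i • u i‖ ≤ K * ‖∑ i ∈ Finset.range n, a i • u i‖) :
    LinearIndependent 𝕜 u := by
  rw [linearIndependent_iff]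
  intro l hl
  obtain ⟨N, hN⟩ := l.support.exists_nat_subset_range
  rw [linearCombination_eq_sum_range u l hN] at hl
  have hz : ∀ m ≤ N, ∑ i ∈ Finset.range m, l i • u i = 0 := fun m hm => by
    have := hK l m N hm
    rw [hl, norm_zero, mul_zero] at this
    exact norm_le_zero_iff.1 this
  ext i
  by_cases hi : i < N
  · have h1 := hz (i + 1) hi
    rw [Finset.sum_range_succ, hz i hi.le, zero_add] at h1
    exact (smul_eq_zero.1 h1).resolve_right (hu i)
  · by_contra h
    exact hi (Finset.mem_range.1 (hN (Finsupp.mem_support_iff.2 h)))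

/-- Grünblum's criterion, sufficiency.  The coordinate functionals on the linear span are bounded
by the hypothesis, and are extended to the closure by the Hahn–Banach theorem. -/
theorem isBasicSequence_of_norm_sum_le {x : ℕ+ → X} {K : ℝ} (hx : ∀ n, x n ≠ 0)
    (hK : ∀ (a : ℕ → 𝕜) (m n : ℕ), m ≤ n →
      ‖∑ i ∈ Finset.range m, a i • x i.succPNat‖ ≤
        K * ‖∑ i ∈ Finset.range n, a i • x i.succPNat‖) :
    IsBasicSequence 𝕜 x := by
  set u : ℕ → X := fun i => x i.succPNat with hu
  have hu0 : ∀ n, u n ≠ 0 := fun n => hx _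
  have hli := linearIndependent_of_norm_sum_le hu0 hK
  set p : Submodule 𝕜 X := Submodule.span 𝕜 (Set.range u) with hp
  have hsum : ∀ v : p, ∃ N, ∀ n, N ≤ n → ∑ i ∈ Finset.range n, hli.repr v i • u i = (v : X) := by
    intro v
    obtain ⟨N, hN⟩ := (hli.repr v).support.exists_nat_subset_range
    refine ⟨N, fun n hn => ?_⟩
    rw [← linearCombination_eq_sum_range u _ (hN.trans (Finset.range_mono hn)),
      hli.linearCombination_repr]
  have hpart : ∀ (v : p) (m : ℕ), ‖∑ i ∈ Finset.range m, hli.repr v i • u i‖ ≤ K * ‖v‖ := by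
    intro v m
    obtain ⟨N, hN⟩ := hsum v
    have := hK (hli.repr v) m (max m N) (le_max_left _ _)
    rwa [hN _ (le_max_right _ _)] at this
  let φ : ∀ i, StrongDual 𝕜 p := fun i =>
    ((Finsupp.lapply i).comp hli.repr).mkContinuous (2 * K / ‖u i‖) fun v => by
      have h1 := hpart v (i + 1)
      have h2 := hpart v i
      have h3 : hli.repr v i • u i = ∑ j ∈ Finset.range (i + 1), hli.repr v j • u j -
          ∑ j ∈ Finset.range i, hli.repr v j • u j := by
        rw [Finset.sum_range_succ]; abel
      have h4 : ‖hli.repr v i‖ * ‖u i‖ ≤ 2 * K * ‖v‖ := by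
        rw [← norm_smul, h3]
        refine (norm_sub_le _ _).trans ?_
        linarith
      rw [div_mul_eq_mul_div, le_div_iff₀ (norm_pos_iff.2 (hu0 i))]
      exact h4
  choose g hg _ using fun i => exists_extension_norm_eq p (φ i)
  have hgr : ∀ i (v : p), g i v = hli.repr v i := fun i v => hg i v
  let P : ℕ → X →L[𝕜] X := fun n => ∑ i ∈ Finset.range n, (g i).smulRight (u i)
  have hP : ∀ n z, P n z = ∑ i ∈ Finset.range n, g i z • u i := fun n z => by
    simp [P]
  have hclos : ∀ n, ∀ z ∈ p.topologicalClosure, ‖P n z‖ ≤ K * ‖z‖ := by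
    intro n z hz
    refine closure_minimal (s := (p : Set X)) (t := {z | ‖P n z‖ ≤ K * ‖z‖}) ?_
      (isClosed_le (by fun_prop) (by fun_prop)) hz
    intro v hv
    change ‖P n v‖ ≤ K * ‖v‖
    rw [hP]
    have := hpart ⟨v, hv⟩ n
    simpa only [← hgr, Submodule.coe_norm] using this
  have hev : ∀ v ∈ p, ∃ N, ∀ n, N ≤ n → P n v = v := by
    intro v hv
    obtain ⟨N, hN⟩ := hsum ⟨v, hv⟩
    refine ⟨N, fun n hn => ?_⟩
    rw [hP]
    simpa only [← hgr] using hN n hn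
  have hK0 : 0 ≤ K := by
    have h := hK (fun _ => 1) 1 1 le_rfl
    simp only [Finset.sum_range_one, one_smul] at h
    by_contra hneg
    have : 0 < ‖u 0‖ := norm_pos_iff.2 (hu0 0)
    have h' : ‖u 0‖ ≤ K * ‖u 0‖ := h
    nlinarith
  have htend : ∀ z ∈ p.topologicalClosure, Tendsto (fun n => P n z) atTop (𝓝 z) := by
    intro z hz
    rw [Metric.tendsto_atTop]
    intro ε hε
    obtain ⟨w, hw, hzw⟩ := Metric.mem_closure_iff.1 hz (ε / (K + 1)) (by positivity)
    obtain ⟨N, hN⟩ := hev w hw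
    refine ⟨N, fun n hn => ?_⟩
    have h1 : P n z - z = P n (z - w) + (w - z) := by rw [map_sub, hN n hn]; abel
    rw [dist_eq_norm, h1]
    have h2 := hclos n (z - w) (sub_mem hz (p.le_topologicalClosure hw))
    rw [dist_eq_norm, lt_div_iff₀ (by positivity)] at hzw
    calc _ ≤ ‖P n (z - w)‖ + ‖w - z‖ := norm_add_le _ _
      _ ≤ K * ‖z - w‖ + ‖z - w‖ := by rw [norm_sub_rev w z]; gcongr
      _ < ε := by linarith
  have hmem : ∀ i, u i ∈ p := fun i => Submodule.subset_span ⟨i, rfl⟩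
  unfold IsBasicSequence closedSpan
  rw [← range_comp_succPNat x]
  refine ⟨⟨fun i => ⟨u i, p.le_topologicalClosure (hmem i)⟩,
    fun i => (g i).comp p.topologicalClosure.subtypeL, fun i j => ?_, fun z => ?_⟩, fun n => rfl⟩
  · change g i (u j) = _
    have : g i (u j) = hli.repr ⟨u j, hmem j⟩ i := hgr i ⟨u j, hmem j⟩
    rw [this, hli.repr_eq_single j _ rfl, Finsupp.single_eq_pi_single]
    congr
  · rw [HasSum, SummationFilter.conditional_filter_eq_map_range, tendsto_map'_iff,
      tendsto_subtype_rng]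
    refine (htend z z.2).congr fun n => ?_
    rw [hP]
    simp

/-- Grünblum's criterion, necessity: the partial-sum projections are uniformly bounded. -/
theorem IsBasicSequence.exists_norm_sum_le [CompleteSpace X] {x : ℕ+ → X}
    (hx : IsBasicSequence 𝕜 x) :
    ∃ K : ℝ, ∀ (a : ℕ → 𝕜) (m n : ℕ), m ≤ n →
      ‖∑ i ∈ Finset.range m, a i • x i.succPNat‖ ≤
        K * ‖∑ i ∈ Finset.range n, a i • x i.succPNat‖ := by
  obtain ⟨b, hb⟩ := hx
  have : CompleteSpace (closedSpan 𝕜 (Set.range x)) :=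
    (Submodule.isClosed_topologicalClosure _).completeSpace_coe
  obtain ⟨K, hK⟩ := b.exists_norm_proj_le
  refine ⟨K, fun a m n hmn => ?_⟩
  have key : ∀ k, ((∑ i ∈ Finset.range k, a i • b i : closedSpan 𝕜 (Set.range x)) : X) =
      ∑ i ∈ Finset.range k, a i • x i.succPNat := fun k => by simp [hb]
  have hproj : b.proj m (∑ i ∈ Finset.range n, a i • b i) = ∑ i ∈ Finset.range m, a i • b i := by
    rw [map_sum]
    simp only [map_smul, SchauderBasis.proj_apply_basis_mem, smul_ite, smul_zero]
    rw [← Finset.sum_filter]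
    congr 1
    ext i
    simp only [Finset.mem_filter, Finset.mem_range]
    omega
  rw [← key, ← key, ← hproj]
  exact (b.proj m).le_of_opNorm_le (hK m) _

theorem IsBasicSequence.ne_zero {x : ℕ+ → X} (hx : IsBasicSequence 𝕜 x) (n : ℕ+) : x n ≠ 0 := by
  obtain ⟨b, hb⟩ := hx
  have := b.linearIndependent.ne_zero n.natPred
  intro h
  apply this
  apply Subtype.ext
  rw [hb, PNat.succPNat_natPred, h]
  rfl

theorem IsBasicSequence.coe [CompleteSpace X] {Y : Submodule 𝕜 X} (hY : IsClosed (Y : Set X))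
    {x : ℕ+ → Y} (hx : IsBasicSequence 𝕜 x) : IsBasicSequence 𝕜 fun n => (x n : X) := by
  have : CompleteSpace Y := hY.completeSpace_coe
  obtain ⟨K, hK⟩ := hx.exists_norm_sum_le
  refine isBasicSequence_of_norm_sum_le (K := K) (fun n h => hx.ne_zero n (Subtype.ext h)) ?_
  intro a m n hmn
  have := hK a m n hmn
  simpa only [Submodule.coe_norm, Submodule.coe_sum, Submodule.coe_smul] using this

/-- A vector annihilated by the functionals of a suitable finite set is almost orthogonal, in the
sense of Birkhoff, to a given finite-dimensional subspace. -/
theorem exists_finset_dual_mul_norm_le (E : Submodule 𝕜 X) [FiniteDimensional 𝕜 E] {c : ℝ}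
    (hc : c < 1) :
    ∃ s : Finset (StrongDual 𝕜 X), ∀ e ∈ E, ∀ v : X, (∀ f ∈ s, f v = 0) → c * ‖e‖ ≤ ‖e + v‖ := by
  classical
  have : ProperSpace E := FiniteDimensional.proper_rclike 𝕜 E
  have hcpt : IsCompact ((↑) '' Metric.sphere (0 : E) 1 : Set X) :=
    (isCompact_sphere _ _).image continuous_subtype_val
  obtain ⟨t, ht, htf, hcov⟩ := hcpt.finite_cover_balls (sub_pos.2 hc)
  choose g hg1 hg2 using fun x : X => exists_dual_vector'' 𝕜 x
  refine ⟨htf.toFinset.image g, fun e he v hv => ?_⟩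
  by_cases he0 : e = 0
  · simp [he0]
  have hne : 0 < ‖e‖ := norm_pos_iff.2 he0
  set r : 𝕜 := ((‖e‖⁻¹ : ℝ) : 𝕜) with hr
  have hrn : ‖r‖ = ‖e‖⁻¹ := by rw [hr, RCLike.norm_ofReal, abs_of_pos (inv_pos.2 hne)]
  have hmem : r • e ∈ ((↑) '' Metric.sphere (0 : E) 1 : Set X) := by
    refine ⟨⟨r • e, E.smul_mem _ he⟩, ?_, rfl⟩
    rw [mem_sphere_zero_iff_norm, Submodule.coe_norm, norm_smul, hrn, inv_mul_cancel₀ hne.ne']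
  obtain ⟨y, hy, hye⟩ := Set.mem_iUnion₂.1 (hcov hmem)
  obtain ⟨y', hy', hyy⟩ := ht hy
  have hy1 : ‖y‖ = 1 := by
    rw [← hyy, ← Submodule.coe_norm]; exact mem_sphere_zero_iff_norm.1 hy'
  have hgv : g y v = 0 := hv _ (Finset.mem_image_of_mem g (htf.mem_toFinset.2 hy))
  -- `y` is a point of the net near the normalised `e`, and `g y` attains the norm of `y`.
  have h1 : g y (r • e + r • v) = g y (r • e - y) + 1 := by
    rw [map_add, map_smul, map_smul, hgv, map_sub, hg2, hy1, map_smul]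
    simp
  have h2 : ‖g y (r • e - y)‖ ≤ 1 - c := by
    refine ((g y).le_of_opNorm_le (hg1 y) _).trans ?_
    rw [one_mul, ← dist_eq_norm]
    exact (Metric.mem_ball.1 hye).le
  have h3 : c ≤ ‖r • e + r • v‖ := by
    have h4 := (g y).le_of_opNorm_le (hg1 y) (r • e + r • v)
    have h5 : (1 : ℝ) ≤ ‖g y (r • e - y) + 1‖ + ‖g y (r • e - y)‖ := by
      have := norm_sub_le (g y (r • e - y) + 1) (g y (r • e - y))
      simpa using this
    rw [h1] at h4
    linarith
  rw [← smul_add, norm_smul, hrn] at h3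
  rwa [le_inv_mul_iff₀ hne, mul_comm] at h3

theorem not_finiteDimensional_iInf_ker {E : Type*} [AddCommGroup E] [Module 𝕜 E]
    (hE : ¬ FiniteDimensional 𝕜 E) (s : Finset (E →ₗ[𝕜] 𝕜)) :
    ¬ FiniteDimensional 𝕜 (⨅ f ∈ s, LinearMap.ker f : Submodule 𝕜 E) := by
  intro h
  apply hE
  let Φ : E →ₗ[𝕜] (s → 𝕜) := LinearMap.pi fun f => f.1
  have hker : LinearMap.ker Φ = ⨅ f ∈ s, LinearMap.ker f := by
    ext v
    simp [Φ, Submodule.mem_iInf, funext_iff]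
  rw [← hker] at h
  have := Φ.quotKerEquivRange.symm.finiteDimensional
  exact Module.Finite.of_submodule_quotient (LinearMap.ker Φ)

/-- In an infinite-dimensional subspace there are unit vectors annihilated by any prescribed
finite set of functionals. -/
theorem exists_norm_eq_one_forall_apply_eq_zero {Z : Submodule 𝕜 X}
    (hZ : ¬ FiniteDimensional 𝕜 Z) (s : Finset (StrongDual 𝕜 X)) :
    ∃ v ∈ Z, ‖v‖ = 1 ∧ ∀ f ∈ s, f v = 0 := by
  classical
  have h := not_finiteDimensional_iInf_ker hZ
    (s.image fun f : StrongDual 𝕜 X => (f : X →ₗ[𝕜] 𝕜).comp Z.subtype)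
  set V := (⨅ f ∈ s.image fun f : StrongDual 𝕜 X => (f : X →ₗ[𝕜] 𝕜).comp Z.subtype,
    LinearMap.ker f :
    Submodule 𝕜 Z) with hV
  have hVne : V ≠ ⊥ := by
    intro hb
    rw [hb] at h
    exact h inferInstance
  obtain ⟨v, hv, hv0⟩ := Submodule.exists_mem_ne_zero_of_ne_bot hVne
  have hv0' : ‖(v : X)‖ ≠ 0 := by simpa using hv0
  refine ⟨((‖(v : X)‖⁻¹ : ℝ) : 𝕜) • (v : X), Z.smul_mem _ v.2, ?_, fun f hf => ?_⟩
  · rw [norm_smul, RCLike.norm_ofReal, abs_of_nonneg (by positivity), inv_mul_cancel₀ hv0']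
  · have : f v = 0 := by
      rw [hV] at hv
      simp only [Submodule.mem_iInf, Finset.mem_image, LinearMap.mem_ker] at hv
      exact hv _ ⟨f, hf, rfl⟩
    rw [map_smul, this, smul_zero]

/-- Mazur's theorem: every infinite-dimensional subspace contains a basic sequence.

The vectors `v n` are chosen together with finite-dimensional spaces `E n` containing
`v 0, …, v n` and finite sets of functionals `s n` such that `v (n + 1)` is almost orthogonal
to `E n`.  The weights `C k = 2 - 1 / (k + 1)` increase, stay in `[1, 2]`, and
`n ↦ C (k n) * ‖S (n + 1)‖` is monotone for the partial sums `S n`; this bounds the projections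
by `2`. -/
theorem exists_isBasicSequence_mem {Z : Submodule 𝕜 X} (hZ : ¬ FiniteDimensional 𝕜 Z) :
    ∃ x : ℕ+ → X, IsBasicSequence 𝕜 x ∧ ∀ n, x n ∈ Z := by
  classical
  let C : ℕ → ℝ := fun k => 2 - 1 / ((k : ℝ) + 1)
  have hCmono : StrictMono C := by
    refine strictMono_nat_of_lt_succ fun k => ?_
    have : 1 / (((k + 1 : ℕ) : ℝ) + 1) < 1 / ((k : ℝ) + 1) := by
      apply one_div_lt_one_div_of_lt (by positivity); push_cast; linarith
    simp only [C]; linarith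
  have hC1 : ∀ k, 1 ≤ C k := fun k => by
    have := hCmono.monotone (Nat.zero_le k)
    have h0 : C 0 = 1 := by simp [C]; norm_num
    linarith
  have hC2 : ∀ k, C k ≤ 2 := fun k => by
    have : 0 < 1 / ((k : ℝ) + 1) := by positivity
    simp only [C]; linarith
  let P : X × Submodule 𝕜 X × Finset (StrongDual 𝕜 X) × ℕ → Prop := fun q =>
    q.1 ∈ Z ∧ ‖q.1‖ = 1 ∧ q.1 ∈ q.2.1 ∧ FiniteDimensional 𝕜 q.2.1 ∧
      ∀ e ∈ q.2.1, ∀ v : X, (∀ f ∈ q.2.2.1, f v = 0) →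
        C q.2.2.2 * ‖e‖ ≤ C (q.2.2.2 + 1) * ‖e + v‖
  let r : X × Submodule 𝕜 X × Finset (StrongDual 𝕜 X) × ℕ →
      X × Submodule 𝕜 X × Finset (StrongDual 𝕜 X) × ℕ → Prop := fun q q' =>
    q.2.1 ≤ q'.2.1 ∧ (∀ f ∈ q.2.2.1, f q'.1 = 0) ∧ q.2.2.2 < q'.2.2.2
  obtain ⟨w, hwP, hwr⟩ := exists_seq_of_forall_finset_exists P r (by
    intro t ht
    obtain ⟨v, hvZ, hv1, hv0⟩ :=
      exists_norm_eq_one_forall_apply_eq_zero hZ (t.biUnion fun q => q.2.2.1)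
    let E : Submodule 𝕜 X := (⨆ q ∈ t, q.2.1) ⊔ Submodule.span 𝕜 {v}
    let k : ℕ := (t.sup fun q => q.2.2.2) + 1
    have hEfin : FiniteDimensional 𝕜 E := by
      have : FiniteDimensional 𝕜 (⨆ q ∈ t, q.2.1 : Submodule 𝕜 X) := by
        rw [← Finset.sup_eq_iSup]
        refine Finset.sup_induction (p := fun V : Submodule 𝕜 X => FiniteDimensional 𝕜 V) ?_ ?_ ?_
        · infer_instance
        · intro a ha b hb
          exact Submodule.finiteDimensional_sup a b
        · intro q hq
          exact (ht q hq).2.2.2.1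
      exact Submodule.finiteDimensional_sup _ _
    have hCpos : 0 < C (k + 1) := zero_lt_one.trans_le (hC1 _)
    obtain ⟨s, hs⟩ := exists_finset_dual_mul_norm_le E (c := C k / C (k + 1))
      ((div_lt_one hCpos).2 (hCmono (Nat.lt_succ_self k)))
    refine ⟨(v, E, s, k), ⟨hvZ, hv1, ?_, hEfin, fun e he u hu => ?_⟩, fun q hq => ⟨?_, ?_, ?_⟩⟩
    · exact (le_sup_right : Submodule.span 𝕜 {v} ≤ E) (Submodule.mem_span_singleton_self v)
    · have := hs e he u hu
      rwa [div_mul_eq_mul_div, div_le_iff₀ hCpos, mul_comm (‖e + u‖)] at this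
    · exact (le_iSup₂ (f := fun q (_ : q ∈ t) => q.2.1) q hq).trans le_sup_left
    · exact fun f hf => hv0 f (Finset.mem_biUnion.2 ⟨q, hq, hf⟩)
    · exact Nat.lt_succ_of_le (Finset.le_sup (f := fun q => q.2.2.2) hq))
  have hstep : ∀ (a : ℕ → 𝕜) (n : ℕ),
      C (w n).2.2.2 * ‖∑ i ∈ Finset.range (n + 1), a i • (w i).1‖ ≤
        C (w (n + 1)).2.2.2 * ‖∑ i ∈ Finset.range (n + 1 + 1), a i • (w i).1‖ := by
    intro a n
    rw [Finset.sum_range_succ _ (n + 1)]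
    refine ((hwP n).2.2.2.2 _ ?_ (a (n + 1) • (w (n + 1)).1) ?_).trans ?_
    · refine Submodule.sum_mem _ fun i hi => Submodule.smul_mem _ _ ?_
      rcases (Nat.lt_succ_iff.1 (Finset.mem_range.1 hi)).lt_or_eq with h | rfl
      · exact (hwr i n h).1 (hwP i).2.2.1
      · exact (hwP i).2.2.1
    · intro f hf
      rw [map_smul, (hwr n (n + 1) n.lt_succ_self).2.1 f hf, smul_zero]
    · gcongr
      exact hCmono.monotone (hwr n (n + 1) n.lt_succ_self).2.2
  refine ⟨fun n => (w n.natPred).1, isBasicSequence_of_norm_sum_le (K := 2) ?_ ?_,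
    fun n => (hwP _).1⟩
  · intro n h
    have := (hwP n.natPred).2.1
    rw [h, norm_zero] at this
    exact zero_ne_one this
  · intro a m n hmn
    simp only [Nat.natPred_succPNat]
    rcases m with _ | m
    · simp
    obtain ⟨n, rfl⟩ : ∃ n', n = n' + 1 := ⟨n - 1, by omega⟩
    have hmono := monotone_nat_of_le_succ (hstep a) (Nat.le_of_succ_le_succ hmn)
    have h1 := hC1 (w m).2.2.2
    have h2 := hC2 (w n).2.2.2
    calc _ ≤ C (w m).2.2.2 * ‖∑ i ∈ Finset.range (m + 1), a i • (w i).1‖ :=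
          le_mul_of_one_le_left (norm_nonneg _) h1
      _ ≤ _ := hmono
      _ ≤ _ := by gcongr

end BasicSequences

/-! ### Operators that are small on infinite-dimensional subspaces -/

section InfinitelySingular

variable {𝕜 X : Type*} [RCLike 𝕜] [NormedAddCommGroup X] [NormedSpace 𝕜 X]

/-- An infinite-dimensional subspace in the sense of Banach space theory: closed linear subspaces
only. -/
def IsInfDimClosed (W : Submodule 𝕜 X) : Prop :=
  IsClosed (W : Set X) ∧ ¬ FiniteDimensional 𝕜 W

/-- `X` is hereditarily indecomposable.  The form used here: the unit sphere of any
infinite-dimensional closed subspace comes arbitrarily close to any other such subspace, the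
distance to `Z` being the norm in `X ⧸ Z`. -/
def IsHereditarilyIndecomposable (𝕜 X : Type*) [RCLike 𝕜] [NormedAddCommGroup X]
    [NormedSpace 𝕜 X] : Prop :=
  ∀ W Z : Submodule 𝕜 X, IsInfDimClosed W → IsInfDimClosed Z → ∀ ε : ℝ, 0 < ε →
    ∃ w ∈ W, ‖w‖ = 1 ∧ ‖Z.mkQL w‖ < ε

theorem norm_mkQL_eq_infDist (Z : Submodule 𝕜 X) (x : X) :
    ‖Z.mkQL x‖ = Metric.infDist x (Z : Set X) :=
  QuotientAddGroup.norm_mk x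

theorem norm_mkQL_le (Z : Submodule 𝕜 X) (x : X) : ‖Z.mkQL x‖ ≤ ‖x‖ :=
  Submodule.Quotient.norm_mk_le Z x

theorem exists_mem_norm_sub_lt {Z : Submodule 𝕜 X} {x : X} {r : ℝ} (h : ‖Z.mkQL x‖ < r) :
    ∃ z ∈ Z, ‖x - z‖ < r := by
  rw [norm_mkQL_eq_infDist, Metric.infDist_lt_iff ⟨0, Z.zero_mem⟩] at h
  simpa only [dist_eq_norm, SetLike.mem_coe] using h

theorem IsSchreierHI.isHereditarilyIndecomposable {c : Ordinal.{0} → ℕ+ → Ordinal.{0}}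
    {ξ : Ordinal.{0}} (hX : IsSchreierHI 𝕜 X c ξ) : IsHereditarilyIndecomposable 𝕜 X := by
  intro W Z hW hZ ε hε
  obtain ⟨x, hx, hxZ⟩ := exists_isBasicSequence_mem hZ.2
  obtain ⟨F, -, w, hwW, hw1, hw⟩ := hX ε hε W hW.1 hW.2 x hx
  refine ⟨w, hwW, hw1, ?_⟩
  rw [norm_mkQL_eq_infDist]
  refine (Metric.infDist_le_infDist_of_subset ?_ ⟨0, Submodule.zero_mem _⟩).trans_lt hw
  refine Submodule.topologicalClosure_minimal _ (Submodule.span_le.2 ?_) hZ.1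
  rintro _ ⟨n, -, rfl⟩
  exact hxZ n

/-- An operator that is not bounded below on any subspace of finite codimension is arbitrarily
small on some infinite-dimensional closed subspace.

The subspace is spanned by unit vectors `v n` with functionals `f n` of norm at most one such that
`f n (v n) = 1` and `f m (v n) = 0` for `m < n`.  This triangular system bounds the coefficients
of `w = ∑ a n • v n` by `‖a n‖ ≤ 2 ^ n * ‖w‖`, so it suffices that `‖S (v n)‖` decays like
`4 ^ (-n)`. -/
theorem exists_isInfDimClosed_norm_le {F : Type*} [SeminormedAddCommGroup F] [NormedSpace 𝕜 F]
    (S : X →L[𝕜] F)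
    (hS : ∀ (s : Finset (StrongDual 𝕜 X)) (ε : ℝ), 0 < ε →
      ∃ v, ‖v‖ = 1 ∧ (∀ f ∈ s, f v = 0) ∧ ‖S v‖ < ε)
    {δ : ℝ} (hδ : 0 < δ) :
    ∃ W : Submodule 𝕜 X, IsInfDimClosed W ∧ ∀ w ∈ W, ‖S w‖ ≤ δ * ‖w‖ := by
  classical
  let P : X × StrongDual 𝕜 X × ℕ → Prop := fun q =>
    ‖q.1‖ = 1 ∧ ‖q.2.1‖ ≤ 1 ∧ q.2.1 q.1 = 1 ∧ ‖S q.1‖ ≤ δ / 2 * (1 / 4) ^ q.2.2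
  let r : X × StrongDual 𝕜 X × ℕ → X × StrongDual 𝕜 X × ℕ → Prop := fun q q' =>
    q.2.1 q'.1 = 0 ∧ q.2.2 < q'.2.2
  obtain ⟨u, huP, hur⟩ := exists_seq_of_forall_finset_exists P r (by
    intro t _
    let k : ℕ := (t.sup fun q => q.2.2) + 1
    obtain ⟨v, hv1, hv0, hvS⟩ := hS (t.image fun q => q.2.1) (δ / 2 * (1 / 4) ^ k) (by positivity)
    obtain ⟨g, hg1, hg2⟩ := exists_dual_vector'' 𝕜 v
    refine ⟨(v, g, k), ⟨hv1, hg1, ?_, hvS.le⟩, fun q hq => ⟨?_, ?_⟩⟩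
    · simp [hg2, hv1]
    · exact hv0 _ (Finset.mem_image_of_mem (fun q : X × StrongDual 𝕜 X × ℕ => q.2.1) hq)
    · exact Nat.lt_succ_of_le (Finset.le_sup (f := fun q => q.2.2) hq))
  have hk : ∀ n, n ≤ (u n).2.2 := fun n =>
    (strictMono_nat_of_lt_succ fun n => (hur n (n + 1) n.lt_succ_self).2).le_apply
  have hcoef : ∀ (a : ℕ → 𝕜) (N n : ℕ), n < N →
      ‖a n‖ ≤ 2 ^ n * ‖∑ i ∈ Finset.range N, a i • (u i).1‖ := by
    intro a N n
    induction n using Nat.strong_induction_on with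
    | _ n ih =>
      intro hn
      set w := ∑ i ∈ Finset.range N, a i • (u i).1 with hw
      have h1 : (u n).2.1 w = ∑ i ∈ Finset.range n, a i * (u n).2.1 (u i).1 + a n := by
        have h2 : (u n).2.1 w = ∑ i ∈ Finset.range (n + 1), a i * (u n).2.1 (u i).1 := by
          rw [hw, map_sum]
          simp only [map_smul, smul_eq_mul]
          symm
          refine Finset.sum_subset (Finset.range_mono hn) fun i _ hi => ?_
          rw [(hur n i (by simpa using hi)).1, mul_zero]
        rw [h2, Finset.sum_range_succ, (huP n).2.2.1, mul_one]
      have h3 : ‖∑ i ∈ Finset.range n, a i * (u n).2.1 (u i).1‖ ≤ (2 ^ n - 1) * ‖w‖ := by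
        have h4 : ((2 : ℝ) ^ n - 1) * ‖w‖ = ∑ i ∈ Finset.range n, 2 ^ i * ‖w‖ := by
          rw [← Finset.sum_mul, geom_sum_eq (by norm_num)]
          norm_num
        rw [h4]
        refine norm_sum_le_of_le _ fun i hi => ?_
        have hi' := Finset.mem_range.1 hi
        have h5 := (u n).2.1.le_of_opNorm_le (huP n).2.1 (u i).1
        rw [(huP i).1, mul_one] at h5
        rw [norm_mul]
        exact (mul_le_of_le_one_right (norm_nonneg _) h5).trans (ih i hi' (hi'.trans hn))
      have h6 := (u n).2.1.le_of_opNorm_le (huP n).2.1 w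
      have h7 : a n = (u n).2.1 w - ∑ i ∈ Finset.range n, a i * (u n).2.1 (u i).1 := by
        rw [h1]; abel
      calc ‖a n‖ ≤ ‖(u n).2.1 w‖ + ‖∑ i ∈ Finset.range n, a i * (u n).2.1 (u i).1‖ := by
            conv_lhs => rw [h7]
            exact norm_sub_le _ _
        _ ≤ 2 ^ n * ‖w‖ := by linarith
  have hli : LinearIndependent 𝕜 fun n => (u n).1 := by
    rw [linearIndependent_iff]
    intro l hl
    obtain ⟨N, hN⟩ := l.support.exists_nat_subset_range
    rw [linearCombination_eq_sum_range _ l hN] at hl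
    ext n
    by_contra h
    have := hcoef l N n (Finset.mem_range.1 (hN (Finsupp.mem_support_iff.2 h)))
    rw [hl, norm_zero, mul_zero] at this
    exact h (norm_le_zero_iff.1 this)
  refine ⟨(Submodule.span 𝕜 (Set.range fun n => (u n).1)).topologicalClosure,
    ⟨Submodule.isClosed_topologicalClosure _, fun hfin => ?_⟩, fun w hw => ?_⟩
  · have hmem : ∀ n, (u n).1 ∈
        (Submodule.span 𝕜 (Set.range fun n => (u n).1)).topologicalClosure := fun n =>
      Submodule.le_topologicalClosure _ (Submodule.subset_span ⟨n, rfl⟩)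
    have hli' : LinearIndependent 𝕜 fun n => (⟨(u n).1, hmem n⟩ :
        (Submodule.span 𝕜 (Set.range fun n => (u n).1)).topologicalClosure) :=
      LinearIndependent.of_comp (Submodule.subtype _) hli
    exact not_finite_iff_infinite.2 (inferInstance : Infinite ℕ) hli'.finite
  · refine closure_minimal (t := {w | ‖S w‖ ≤ δ * ‖w‖}) ?_
      (isClosed_le (by fun_prop) (by fun_prop)) hw
    intro w hw
    obtain ⟨a, N, rfl⟩ := exists_sum_range_of_mem_span hw
    change ‖S _‖ ≤ δ * ‖_‖
    set w := ∑ i ∈ Finset.range N, a i • (u i).1 with hwdef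
    have hterm : ∀ i ∈ Finset.range N, ‖a i • S (u i).1‖ ≤ (1 / 2) ^ i * (δ / 2 * ‖w‖) := by
      intro i hi
      have h1 := hcoef a N i (Finset.mem_range.1 hi)
      have h2 : ‖S (u i).1‖ ≤ δ / 2 * (1 / 4) ^ i := (huP i).2.2.2.trans (by
        gcongr ?_ * ?_
        exact pow_le_pow_of_le_one (by norm_num) (by norm_num) (hk i))
      rw [norm_smul]
      calc _ ≤ (2 ^ i * ‖w‖) * (δ / 2 * (1 / 4) ^ i) := by gcongr
        _ = (2 * (1 / 4)) ^ i * (δ / 2 * ‖w‖) := by rw [mul_pow]; ring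
        _ = _ := by norm_num
    calc ‖S w‖ = ‖∑ i ∈ Finset.range N, a i • S (u i).1‖ := by
          rw [hwdef, map_sum]; simp only [map_smul]
      _ ≤ ∑ i ∈ Finset.range N, (1 / 2) ^ i * (δ / 2 * ‖w‖) := norm_sum_le_of_le _ hterm
      _ = (∑ i ∈ Finset.range N, (1 / 2 : ℝ) ^ i) * (δ / 2 * ‖w‖) := by rw [Finset.sum_mul]
      _ ≤ 2 * (δ / 2 * ‖w‖) := by gcongr; exact sum_geometric_two_le N
      _ = δ * ‖w‖ := by ring

/-- Either `S` is bounded below on an infinite-dimensional closed subspace, or it is arbitrarily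
small on some such subspace. -/
theorem exists_isInfDimClosed_norm_le_of_not_bounded_below {F : Type*} [SeminormedAddCommGroup F]
    [NormedSpace 𝕜 F] (hX : ¬ FiniteDimensional 𝕜 X) (S : X →L[𝕜] F)
    (hS : ¬ ∃ V : Submodule 𝕜 X, IsInfDimClosed V ∧ ∃ ε > 0, ∀ v ∈ V, ε * ‖v‖ ≤ ‖S v‖)
    {δ : ℝ} (hδ : 0 < δ) :
    ∃ W : Submodule 𝕜 X, IsInfDimClosed W ∧ ∀ w ∈ W, ‖S w‖ ≤ δ * ‖w‖ := by
  classical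
  refine exists_isInfDimClosed_norm_le S (fun s ε hε => ?_) hδ
  by_contra! hcon
  set V : Submodule 𝕜 X := ⨅ f ∈ s.image fun f : StrongDual 𝕜 X => (f : X →ₗ[𝕜] 𝕜),
    LinearMap.ker f with hVdef
  have hVmem : ∀ v, v ∈ V ↔ ∀ f ∈ s, f v = 0 := fun v => by
    simp [hVdef, Submodule.mem_iInf]
  have hVcl : IsClosed (V : Set X) := by
    have : (V : Set X) = ⋂ f ∈ s, {v | f v = 0} := by
      ext v
      simp [hVmem]
    rw [this]
    exact isClosed_biInter fun f _ => isClosed_eq (by fun_prop) (by fun_prop)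
  refine hS ⟨V, ⟨hVcl, not_finiteDimensional_iInf_ker hX _⟩, ε, hε, fun v hv => ?_⟩
  by_cases hv0 : v = 0
  · simp [hv0]
  have hne : 0 < ‖v‖ := norm_pos_iff.2 hv0
  have hrn : ‖((‖v‖⁻¹ : ℝ) : 𝕜)‖ = ‖v‖⁻¹ := by
    rw [RCLike.norm_ofReal, abs_of_pos (inv_pos.2 hne)]
  have := hcon (((‖v‖⁻¹ : ℝ) : 𝕜) • v) (by rw [norm_smul, hrn, inv_mul_cancel₀ hne.ne'])
    ((hVmem _).1 (V.smul_mem _ hv))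
  rwa [map_smul, norm_smul, hrn, le_inv_mul_iff₀ hne, mul_comm] at this

theorem IsInfDimClosed.map_subtype {Y : Submodule 𝕜 X} (hY : IsClosed (Y : Set X))
    {V : Submodule 𝕜 Y} (hV : IsInfDimClosed V) : IsInfDimClosed (V.map Y.subtype) := by
  refine ⟨?_, fun h => hV.2 ?_⟩
  · rw [Submodule.map_coe]
    exact hY.isClosedEmbedding_subtypeVal.isClosedMap _ hV.1
  · exact (Submodule.equivMapOfInjective _ Y.injective_subtype V).symm.finiteDimensional

/-- In a hereditarily indecomposable Banach space, an operator on a subspace `Y` maps some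
infinite-dimensional subspace of `Y` almost into any given infinite-dimensional subspace `Z`.

Otherwise `T` composed with the quotient map `X → X ⧸ Z` would be bounded below on some
infinite-dimensional `V`.  Then `T` maps `V` isomorphically onto a closed subspace that stays away
from `Z`, contrary to hereditary indecomposability. -/
theorem IsHereditarilyIndecomposable.exists_norm_mkQL_le [CompleteSpace X]
    (hX : IsHereditarilyIndecomposable 𝕜 X) {Y Z : Submodule 𝕜 X} (hY : IsInfDimClosed Y)
    (hZ : IsInfDimClosed Z) (T : Y →L[𝕜] X) {δ : ℝ} (hδ : 0 < δ) :
    ∃ W ≤ Y, IsInfDimClosed W ∧ ∀ w : Y, (w : X) ∈ W → ‖Z.mkQL (T w)‖ ≤ δ * ‖w‖ := by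
  have : CompleteSpace Y := hY.1.completeSpace_coe
  obtain ⟨W, hW, hWδ⟩ := exists_isInfDimClosed_norm_le_of_not_bounded_below hY.2
    (Z.mkQL.comp T) (by
    rintro ⟨V, hV, ε, hε, hlow⟩
    replace hlow : ∀ v ∈ V, ε * ‖v‖ ≤ ‖Z.mkQL (T v)‖ := hlow
    have hlow' : ∀ v : V, ‖v‖ ≤ (Real.toNNReal ε⁻¹ : ℝ) * ‖(T.comp V.subtypeL) v‖ := by
      intro v
      rw [Real.coe_toNNReal _ (inv_pos.2 hε).le, le_inv_mul_iff₀ hε]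
      exact (hlow v v.2).trans (norm_mkQL_le Z _)
    have hanti : AntilipschitzWith (Real.toNNReal ε⁻¹) (T.comp V.subtypeL) :=
      ContinuousLinearMap.antilipschitz_of_bound _ hlow'
    have : CompleteSpace V := hV.1.completeSpace_coe
    have hR : IsInfDimClosed (LinearMap.range (T.comp V.subtypeL : V →ₗ[𝕜] X)) := by
      refine ⟨?_, fun h => hV.2 ?_⟩
      · exact hanti.isClosed_range (T.comp V.subtypeL).uniformContinuous
      · exact (LinearEquiv.ofInjective (T.comp V.subtypeL : V →ₗ[𝕜] X)
          hanti.injective).symm.finiteDimensional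
    obtain ⟨_, ⟨v, rfl⟩, hv1, hv2⟩ := hX _ Z hR hZ (ε / (‖T‖ + 1)) (by positivity)
    change ‖T v‖ = 1 at hv1
    change ‖Z.mkQL (T v)‖ < _ at hv2
    have h1 := (hlow v v.2).trans_lt hv2
    have h2 := T.le_opNorm (v : Y)
    rw [lt_div_iff₀ (by positivity)] at h1
    have h3 : ‖(v : Y)‖ * (‖T‖ + 1) < 1 := by
      have : ε * (‖(v : Y)‖ * (‖T‖ + 1)) < ε * 1 := by linarith
      exact lt_of_mul_lt_mul_left this hε.le
    nlinarith [norm_nonneg (v : Y)]) hδ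
  refine ⟨W.map Y.subtype, Submodule.map_subtype_le Y W, hW.map_subtype hY.1, ?_⟩
  rintro w ⟨w', hw', hww'⟩
  obtain rfl : w' = w := Subtype.ext hww'
  exact hWδ _ hw'

/-- Finitely many infinite-dimensional closed subspaces of a hereditarily indecomposable space
almost have an infinite-dimensional subspace in common. -/
theorem IsHereditarilyIndecomposable.exists_forall_norm_mkQL_le [CompleteSpace X]
    (hX : IsHereditarilyIndecomposable 𝕜 X) {Y : Submodule 𝕜 X} (hY : IsInfDimClosed Y)
    (s : Finset {Z : Submodule 𝕜 X // IsInfDimClosed Z}) {δ : ℝ} (hδ : 0 < δ) :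
    ∃ W ≤ Y, IsInfDimClosed W ∧ ∀ Z ∈ s, ∀ w ∈ W, ‖Z.1.mkQL w‖ ≤ δ * ‖w‖ := by
  classical
  induction s using Finset.induction_on with
  | empty => exact ⟨Y, le_rfl, hY, by simp⟩
  | insert Z s _ ih =>
    obtain ⟨W, hWY, hW, hWs⟩ := ih
    obtain ⟨W', hW'W, hW', hW'Z⟩ := hX.exists_norm_mkQL_le hW Z.2 W.subtypeL hδ
    refine ⟨W', hW'W.trans hWY, hW', fun Z' hZ' w hw => ?_⟩
    rcases Finset.mem_insert.1 hZ' with rfl | h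
    · exact hW'Z ⟨w, hW'W hw⟩ hw
    · exact hWs Z' h w (hW'W hw)

end InfinitelySingular

/-! ### Approximate eigenvalues -/

/-- An operator on a nonzero complex Banach space has an approximate eigenvalue, namely any point
of the boundary of its spectrum. -/
theorem exists_forall_norm_apply_sub_smul_lt {Q : Type*} [NormedAddCommGroup Q] [NormedSpace ℂ Q]
    [CompleteSpace Q] [Nontrivial Q] (A : Q →L[ℂ] Q) :
    ∃ μ : ℂ, ∀ ε : ℝ, 0 < ε → ∃ q, ‖q‖ = 1 ∧ ‖A q - μ • q‖ < ε := by
  obtain ⟨μ, hμ⟩ : (frontier (spectrum ℂ A)).Nonempty :=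
    nonempty_frontier_iff.2 ⟨spectrum.nonempty A, (spectrum.isCompact A).ne_univ⟩
  refine ⟨μ, fun ε hε => ?_⟩
  by_contra! hcon
  have hlow : ∀ q, ε * ‖q‖ ≤ ‖A q - μ • q‖ := by
    intro q
    by_cases hq : q = 0
    · simp [hq]
    have hne : 0 < ‖q‖ := norm_pos_iff.2 hq
    have hrn : ‖((‖q‖⁻¹ : ℝ) : ℂ)‖ = ‖q‖⁻¹ := by
      rw [Complex.norm_real, Real.norm_of_nonneg (inv_pos.2 hne).le]
    have := hcon (((‖q‖⁻¹ : ℝ) : ℂ) • q) (by rw [norm_smul, hrn, inv_mul_cancel₀ hne.ne'])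
    rw [map_smul, smul_comm μ, ← smul_sub, norm_smul, hrn, le_inv_mul_iff₀ hne, mul_comm] at this
    exact this
  have hμmem : μ ∈ spectrum ℂ A := (spectrum.isClosed A).frontier_subset hμ
  have hμcl : μ ∈ closure (spectrum ℂ A)ᶜ := by
    rw [closure_compl]
    exact hμ.2
  obtain ⟨ν, hν, hνμ⟩ := Metric.mem_closure_iff.1 hμcl (ε / 2) (by positivity)
  rw [dist_eq_norm] at hνμ
  obtain ⟨U, hU⟩ : IsUnit (algebraMap ℂ (Q →L[ℂ] Q) ν - A) := by
    by_contra h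
    exact hν h
  -- The lower bound for `A - μ` passes to `A - ν` and bounds the resolvent at `ν` by `2 / ε`.
  have hR : ‖(↑U⁻¹ : Q →L[ℂ] Q)‖ ≤ 2 / ε := by
    refine ContinuousLinearMap.opNorm_le_bound _ (by positivity) fun q => ?_
    set p := (↑U⁻¹ : Q →L[ℂ] Q) q with hp
    have hUp : ν • p - A p = q := by
      have h1 : (U * ↑U⁻¹ : Q →L[ℂ] Q) q = q := by simp
      rw [mul_apply_eq_comp, hU] at h1
      simpa [Algebra.algebraMap_eq_smul_one] using h1
    have h2 : A p - μ • p = -q - (μ - ν) • p := by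
      rw [← hUp, sub_smul]; abel
    have h3 := hlow p
    rw [h2] at h3
    have h4 : ‖-q - (μ - ν) • p‖ ≤ ‖q‖ + ‖μ - ν‖ * ‖p‖ := by
      refine (norm_sub_le _ _).trans ?_
      rw [norm_neg, norm_smul]
    have h5 : ‖μ - ν‖ * ‖p‖ ≤ ε / 2 * ‖p‖ := by gcongr
    rw [div_mul_eq_mul_div, le_div_iff₀ hε]
    linarith
  have hRpos : 0 < ‖(↑U⁻¹ : Q →L[ℂ] Q)‖ := norm_pos_iff.2 U⁻¹.ne_zero
  have hlt : ‖algebraMap ℂ (Q →L[ℂ] Q) (μ - ν)‖ < ‖(↑U⁻¹ : Q →L[ℂ] Q)‖⁻¹ := by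
    rw [norm_algebraMap']
    refine hνμ.trans_le ?_
    rw [le_inv_comm₀ (by positivity) hRpos, inv_div]
    exact hR
  refine hμmem ?_
  rw [resolventSet, Set.mem_ofPred_eq]
  have : algebraMap ℂ (Q →L[ℂ] Q) μ - A = ↑(U.add _ hlt) := by
    rw [Units.val_add, hU, map_sub]; abel
  rw [this]
  exact Units.isUnit _

/-! ### Families that are asymptotically close to every infinite-dimensional subspace -/

section GenericFamilies

open BoundedContinuousFunction

variable {I : Type*} [TopologicalSpace I] (l : Filter I)
variable {X E E' F : Type*} [NormedAddCommGroup X] [NormedSpace ℂ X]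
  [NormedAddCommGroup E] [NormedSpace ℂ E] [NormedAddCommGroup E'] [NormedSpace ℂ E']
  [SeminormedAddCommGroup F] [NormedSpace ℂ F]

/-- The bounded families `y` (functions on the discrete space `I`) such that `A (y i)` tends to
zero along `l`. -/
noncomputable def nullFamilies (A : E →L[ℂ] F) : Submodule ℂ (I →ᵇ E) where
  carrier := {y | Tendsto (fun i => A (y i)) l (𝓝 0)}
  add_mem' {y z} hy hz := by simpa using Tendsto.add hy hz
  zero_mem' := by simpa using tendsto_const_nhds
  smul_mem' a y hy := by simpa using Tendsto.const_smul hy a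

theorem mem_nullFamilies {A : E →L[ℂ] F} {y : I →ᵇ E} :
    y ∈ nullFamilies l A ↔ Tendsto (fun i => A (y i)) l (𝓝 0) := Iff.rfl

theorem isClosed_nullFamilies (A : E →L[ℂ] F) :
    IsClosed (nullFamilies l A : Set (I →ᵇ E)) := by
  refine isClosed_of_closure_subset fun y hy => ?_
  change Tendsto (fun i => A (y i)) l (𝓝 0)
  rw [Metric.tendsto_nhds]
  intro ε hε
  obtain ⟨z, hz, hyz⟩ := Metric.mem_closure_iff.1 hy (ε / 2 / (‖A‖ + 1)) (by positivity)
  have hz' : Tendsto (fun i => A (z i)) l (𝓝 0) := hz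
  filter_upwards [Metric.tendsto_nhds.1 hz' (ε / 2) (by positivity)] with i hi
  rw [dist_zero_right] at hi ⊢
  have h1 : ‖y i - z i‖ ≤ dist y z := by
    rw [← dist_eq_norm]; exact BoundedContinuousFunction.dist_coe_le_dist i
  have h2 : ‖A (y i - z i)‖ ≤ (‖A‖ + 1) * (ε / 2 / (‖A‖ + 1)) :=
    (A.le_opNorm _).trans (by
      gcongr
      · linarith
      · exact h1.trans hyz.le)
  rw [mul_div_cancel₀ _ (by positivity)] at h2
  calc ‖A (y i)‖ = ‖A (y i - z i) + A (z i)‖ := by rw [map_sub, sub_add_cancel]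
    _ ≤ ‖A (y i - z i)‖ + ‖A (z i)‖ := norm_add_le _ _
    _ < ε := by linarith

/-- The bounded families in `E` whose images in `X` approach, along `l`, every
infinite-dimensional closed subspace of `X`. -/
noncomputable def genericFamilies (j : E →L[ℂ] X) : Submodule ℂ (I →ᵇ E) :=
  ⨅ W : {W : Submodule ℂ X // IsInfDimClosed W}, nullFamilies l (W.1.mkQL.comp j)

theorem mem_genericFamilies {j : E →L[ℂ] X} {y : I →ᵇ E} :
    y ∈ genericFamilies l j ↔ ∀ W : Submodule ℂ X, IsInfDimClosed W →
      Tendsto (fun i => W.mkQL (j (y i))) l (𝓝 0) := by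
  simp [genericFamilies, Submodule.mem_iInf, mem_nullFamilies]

theorem isClosed_genericFamilies (j : E →L[ℂ] X) :
    IsClosed (genericFamilies l j : Set (I →ᵇ E)) := by
  rw [genericFamilies, Submodule.coe_iInf]
  exact isClosed_iInter fun W => isClosed_nullFamilies l _

/-- The generic families that tend to zero along `l`. -/
noncomputable def nullGenericFamilies (j : E →L[ℂ] X) : Submodule ℂ (genericFamilies l j) :=
  (nullFamilies l (ContinuousLinearMap.id ℂ E)).comap (genericFamilies l j).subtype

theorem mem_nullGenericFamilies {j : E →L[ℂ] X} {y : genericFamilies l j} :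
    y ∈ nullGenericFamilies l j ↔ Tendsto (fun i => y.1 i) l (𝓝 0) := Iff.rfl

instance isClosed_nullGenericFamilies (j : E →L[ℂ] X) :
    IsClosed (nullGenericFamilies l j : Set (genericFamilies l j)) :=
  (isClosed_nullFamilies l _).preimage continuous_subtype_val

/-- The generic families modulo those tending to zero; the norm of a class is the upper limit
of the norms along `l`. -/
def GenericSpace (j : E →L[ℂ] X) : Type _ :=
  genericFamilies l j ⧸ nullGenericFamilies l j

noncomputable instance (j : E →L[ℂ] X) : NormedAddCommGroup (GenericSpace l j) :=
  inferInstanceAs (NormedAddCommGroup (genericFamilies l j ⧸ nullGenericFamilies l j))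

noncomputable instance (j : E →L[ℂ] X) : NormedSpace ℂ (GenericSpace l j) :=
  inferInstanceAs (NormedSpace ℂ (genericFamilies l j ⧸ nullGenericFamilies l j))

theorem completeSpace_genericSpace [CompleteSpace E] (j : E →L[ℂ] X) :
    CompleteSpace (GenericSpace l j) := by
  have : CompleteSpace (genericFamilies l j) := (isClosed_genericFamilies l j).completeSpace_coe
  exact inferInstanceAs (CompleteSpace (genericFamilies l j ⧸ nullGenericFamilies l j))

variable {l}

/-- The class of a generic family. -/
noncomputable def genericMk (j : E →L[ℂ] X) : genericFamilies l j →L[ℂ] GenericSpace l j :=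
  (nullGenericFamilies l j).mkQL

theorem genericMk_surjective (j : E →L[ℂ] X) : Function.Surjective (genericMk (l := l) j) :=
  Submodule.Quotient.mk_surjective _

theorem genericMk_eq_zero {j : E →L[ℂ] X} {y : genericFamilies l j} :
    genericMk j y = 0 ↔ Tendsto (fun i => y.1 i) l (𝓝 0) :=
  Submodule.Quotient.mk_eq_zero _

theorem eventually_norm_lt_of_norm_genericMk_lt {j : E →L[ℂ] X} {y : genericFamilies l j} {r : ℝ}
    (h : ‖genericMk j y‖ < r) : ∀ᶠ i in l, ‖y.1 i‖ < r := by
  obtain ⟨z, hz, hyz⟩ := exists_mem_norm_sub_lt h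
  have hz' : Tendsto (fun i => z.1 i) l (𝓝 0) := hz
  filter_upwards [Metric.tendsto_nhds.1 hz' (r - ‖y - z‖) (sub_pos.2 hyz)] with i hi
  rw [dist_zero_right] at hi
  have h1 : ‖y.1 i - z.1 i‖ ≤ ‖y - z‖ := (y - z).1.norm_coe_le_norm i
  calc ‖y.1 i‖ = ‖(y.1 i - z.1 i) + z.1 i‖ := by rw [sub_add_cancel]
    _ ≤ ‖y.1 i - z.1 i‖ + ‖z.1 i‖ := norm_add_le _ _
    _ < r := by linarith

theorem norm_genericMk_le_of_eventually [DiscreteTopology I] {j : E →L[ℂ] X}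
    {y : genericFamilies l j} {r : ℝ} (hr : 0 ≤ r)
    (h : ∀ᶠ i in l, ‖y.1 i‖ ≤ r) : ‖genericMk j y‖ ≤ r := by
  classical
  -- Replacing the terms of norm exceeding `r` by zero does not change the class.
  let z : I →ᵇ E := ofNormedAddCommGroupDiscrete (fun i => if ‖y.1 i‖ ≤ r then y.1 i else 0) r
    fun i => by
      split_ifs with hi
      · exact hi
      · simpa using hr
  have hzy : ∀ᶠ i in l, z i = y.1 i := h.mono fun i hi => if_pos hi
  have hz : z ∈ genericFamilies l j := by
    rw [mem_genericFamilies]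
    intro W hW
    refine ((mem_genericFamilies l).1 y.2 W hW).congr' ?_
    filter_upwards [hzy] with i hi
    rw [hi]
  have hmk : genericMk j y = genericMk j ⟨z, hz⟩ := by
    rw [← sub_eq_zero, ← map_sub, genericMk_eq_zero]
    refine tendsto_const_nhds.congr' ?_
    filter_upwards [hzy] with i hi
    change 0 = y.1 i - z i
    rw [hi, sub_self]
  rw [hmk]
  refine (norm_mkQL_le (nullGenericFamilies l j) _).trans ?_
  change ‖z‖ ≤ r
  refine (BoundedContinuousFunction.norm_le hr).2 fun i => ?_
  change ‖if ‖y.1 i‖ ≤ r then y.1 i else 0‖ ≤ r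
  split_ifs with hi
  · exact hi
  · simpa using hr

/-- The operator between spaces of generic families obtained by applying `S` at every index. -/
noncomputable def genericMap {j : E →L[ℂ] X} {j' : E' →L[ℂ] X} (S : E →L[ℂ] E')
    (hS : ∀ y ∈ genericFamilies l j,
      S.compLeftContinuousBounded I y ∈ genericFamilies l j') :
    GenericSpace l j →L[ℂ] GenericSpace l j' :=
  (nullGenericFamilies l j).liftQL
    ((genericMk j').comp ((S.compLeftContinuousBounded I).restrict hS)) (by
      intro y hy
      rw [mem_nullGenericFamilies] at hy
      refine genericMk_eq_zero.2 ?_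
      have := (S.continuous.tendsto 0).comp hy
      rwa [map_zero] at this)

theorem genericMap_genericMk {j : E →L[ℂ] X} {j' : E' →L[ℂ] X} (S : E →L[ℂ] E')
    (hS : ∀ y ∈ genericFamilies l j,
      S.compLeftContinuousBounded I y ∈ genericFamilies l j') (y : genericFamilies l j) :
    genericMap S hS (genericMk j y) =
      genericMk j' ⟨S.compLeftContinuousBounded I y.1, hS y.1 y.2⟩ := rfl

end GenericFamilies

/-! ### Operators on generic families -/

section GenericOperators

open BoundedContinuousFunction

variable {I : Type*} [TopologicalSpace I] {l : Filter I}
variable {X : Type*} [NormedAddCommGroup X] [NormedSpace ℂ X] {Y : Submodule ℂ X}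

/-- A generic family in `Y` is asymptotically in every `W`, so an operator that is arbitrarily
small on suitable `W` sends it to a null family. -/
theorem tendsto_apply_of_mem_genericFamilies {F : Type*} [SeminormedAddCommGroup F]
    [NormedSpace ℂ F] (S : Y →L[ℂ] F)
    (hS : ∀ δ : ℝ, 0 < δ → ∃ W ≤ Y, IsInfDimClosed W ∧ ∀ w : Y, (w : X) ∈ W → ‖S w‖ ≤ δ * ‖w‖)
    {y : I →ᵇ Y} (hy : y ∈ genericFamilies l Y.subtypeL) :
    Tendsto (fun i => S (y i)) l (𝓝 0) := by
  rw [Metric.tendsto_nhds]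
  intro ε hε
  obtain ⟨W, hWY, hW, hWS⟩ := hS (ε / 2 / (‖y‖ + 1)) (by positivity)
  have hη : 0 < min 1 (ε / 2 / (‖S‖ + 1)) := lt_min one_pos (by positivity)
  filter_upwards [Metric.tendsto_nhds.1 ((mem_genericFamilies l).1 hy W hW) _ hη] with i hi
  rw [dist_zero_right] at hi ⊢
  obtain ⟨w, hw, hwi⟩ := exists_mem_norm_sub_lt hi
  have hwi' : ‖y i - ⟨w, hWY hw⟩‖ < min 1 (ε / 2 / (‖S‖ + 1)) := hwi
  have h1 : ‖S (y i - ⟨w, hWY hw⟩)‖ < ε / 2 := by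
    refine (S.le_opNorm _).trans_lt ?_
    have := hwi'.trans_le (min_le_right _ _)
    rw [lt_div_iff₀ (by positivity)] at this
    nlinarith [norm_nonneg (y i - ⟨w, hWY hw⟩)]
  have h2 : ‖S ⟨w, hWY hw⟩‖ ≤ ε / 2 := by
    refine (hWS ⟨w, hWY hw⟩ hw).trans ?_
    have h3 : ‖(⟨w, hWY hw⟩ : Y)‖ ≤ ‖y‖ + 1 := by
      have h4 := norm_sub_norm_le (⟨w, hWY hw⟩ : Y) (y i)
      rw [norm_sub_rev] at h4
      have h5 := hwi'.trans_le (min_le_left _ _)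
      have h6 := y.norm_coe_le_norm i
      linarith
    calc _ ≤ ε / 2 / (‖y‖ + 1) * (‖y‖ + 1) := by gcongr
      _ = ε / 2 := div_mul_cancel₀ _ (by positivity)
  calc ‖S (y i)‖ = ‖S (y i - ⟨w, hWY hw⟩) + S ⟨w, hWY hw⟩‖ := by rw [← map_add, sub_add_cancel]
    _ ≤ ‖S (y i - ⟨w, hWY hw⟩)‖ + ‖S ⟨w, hWY hw⟩‖ := norm_add_le _ _
    _ < ε := by linarith

theorem IsHereditarilyIndecomposable.compLeft_mem_genericFamilies [CompleteSpace X]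
    (hX : IsHereditarilyIndecomposable ℂ X) (hY : IsInfDimClosed Y) (T : Y →L[ℂ] X) :
    ∀ y ∈ genericFamilies l Y.subtypeL,
      T.compLeftContinuousBounded I y ∈ genericFamilies l (ContinuousLinearMap.id ℂ X) := by
  intro y hy
  rw [mem_genericFamilies]
  intro Z hZ
  exact tendsto_apply_of_mem_genericFamilies (Z.mkQL.comp T)
    (fun δ hδ => hX.exists_norm_mkQL_le hY hZ T hδ) hy

theorem compLeft_subtypeL_mem_genericFamilies :
    ∀ y ∈ genericFamilies l Y.subtypeL,
      Y.subtypeL.compLeftContinuousBounded I y ∈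
        genericFamilies l (ContinuousLinearMap.id ℂ X) := by
  intro y hy
  rw [mem_genericFamilies] at hy ⊢
  exact hy

/-- Generic families in `X` are asymptotically in `Y`, so up to null families they are the same
as generic families in `Y`. -/
theorem bijective_genericMap_subtypeL [DiscreteTopology I] (hY : IsInfDimClosed Y) :
    Function.Bijective (genericMap (l := l) (I := I) Y.subtypeL
      compLeft_subtypeL_mem_genericFamilies) := by
  constructor
  · rw [injective_iff_map_eq_zero]
    intro q hq
    obtain ⟨y, rfl⟩ := genericMk_surjective _ q
    rw [genericMap_genericMk, genericMk_eq_zero] at hq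
    rw [genericMk_eq_zero]
    exact tendsto_subtype_rng.2 hq
  · intro q
    obtain ⟨x, rfl⟩ := genericMk_surjective _ q
    -- The factor `2` makes up for the distance not being attained; where it vanishes, `x i` is in
    -- the closed subspace `Y` itself.
    have hex : ∀ i, ∃ y : Y, ‖x.1 i - y‖ ≤ 2 * ‖Y.mkQL (x.1 i)‖ := by
      intro i
      by_cases h0 : ‖Y.mkQL (x.1 i)‖ = 0
      · rw [norm_mkQL_eq_infDist] at h0
        have : x.1 i ∈ Y := by
          have := (hY.1.mem_iff_infDist_zero ⟨0, Y.zero_mem⟩).2 h0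
          exact this
        exact ⟨⟨x.1 i, this⟩, by simp⟩
      · have hpos : 0 < ‖Y.mkQL (x.1 i)‖ := lt_of_le_of_ne (norm_nonneg _) (Ne.symm h0)
        obtain ⟨z, hz, hxz⟩ := exists_mem_norm_sub_lt (show ‖Y.mkQL (x.1 i)‖ <
          2 * ‖Y.mkQL (x.1 i)‖ by linarith)
        exact ⟨⟨z, hz⟩, hxz.le⟩
    choose y hy using hex
    have hbd : ∀ i, ‖y i‖ ≤ 3 * ‖x.1‖ := by
      intro i
      have h1 := norm_sub_norm_le (y i : X) (x.1 i)
      rw [norm_sub_rev] at h1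
      have h2 := hy i
      have h3 := norm_mkQL_le Y (x.1 i)
      have h4 := x.1.norm_coe_le_norm i
      rw [Submodule.coe_norm]
      linarith
    let y' : I →ᵇ Y := ofNormedAddCommGroupDiscrete y _ hbd
    have hx := (mem_genericFamilies l).1 x.2
    have hlim : Tendsto (fun i => (y i : X) - x.1 i) l (𝓝 0) := by
      have h1 := (hx Y hY).norm.const_mul 2
      rw [norm_zero, mul_zero] at h1
      refine squeeze_zero_norm (fun i => ?_) h1
      rw [norm_sub_rev]
      exact hy i
    have hy' : y' ∈ genericFamilies l Y.subtypeL := by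
      rw [mem_genericFamilies]
      intro W hW
      have h1 := ((W.mkQL.continuous.tendsto 0).comp hlim).add (hx W hW)
      rw [map_zero, add_zero] at h1
      refine h1.congr fun i => ?_
      change W.mkQL (y i - x.1 i) + W.mkQL (x.1 i) = W.mkQL (y i)
      rw [map_sub, sub_add_cancel]
    refine ⟨genericMk Y.subtypeL ⟨y', hy'⟩, ?_⟩
    rw [genericMap_genericMk]
    rw [← sub_eq_zero, ← map_sub, genericMk_eq_zero]
    exact hlim

/-- If `S` is bounded below on an infinite-dimensional subspace, then it is bounded below on
generic families. -/
theorem eventually_norm_lt_of_bounded_below (S : Y →L[ℂ] X) (hY : IsClosed (Y : Set X))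
    {V : Submodule ℂ Y} (hV : IsInfDimClosed V) {ε : ℝ} (hε : 0 < ε)
    (hlow : ∀ v ∈ V, ε * ‖v‖ ≤ ‖S v‖) {y : I →ᵇ Y} (hy : y ∈ genericFamilies l Y.subtypeL)
    {r : ℝ} (hS : ∀ᶠ i in l, ‖S (y i)‖ < ε * r) : ∀ᶠ i in l, ‖y i‖ < 2 * r := by
  rcases l.eq_or_neBot with rfl | hne
  · simp
  have hr : 0 < r := by
    obtain ⟨i, hi⟩ := hS.exists
    exact pos_of_mul_pos_right ((norm_nonneg _).trans_lt hi) hε.le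
  filter_upwards [hS, Metric.tendsto_nhds.1 ((mem_genericFamilies l).1 hy _
    (hV.map_subtype hY)) (ε * r / (‖S‖ + ε)) (by positivity)] with i hi hi'
  rw [dist_zero_right] at hi'
  obtain ⟨_, ⟨v, hv, rfl⟩, hvi⟩ := exists_mem_norm_sub_lt hi'
  have hvi' : ‖y i - v‖ < ε * r / (‖S‖ + ε) := hvi
  rw [lt_div_iff₀ (by positivity)] at hvi'
  have h1 : ‖S v‖ ≤ ‖S (y i)‖ + ‖S‖ * ‖y i - v‖ := by
    calc ‖S v‖ = ‖S (y i) - S (y i - v)‖ := by rw [← map_sub, sub_sub_cancel]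
      _ ≤ ‖S (y i)‖ + ‖S (y i - v)‖ := norm_sub_le _ _
      _ ≤ _ := by gcongr; exact S.le_opNorm _
  have h2 : ‖y i‖ ≤ ‖v‖ + ‖y i - v‖ := by
    calc ‖y i‖ = ‖v + (y i - v)‖ := by rw [add_sub_cancel]
      _ ≤ _ := norm_add_le _ _
  have h3 := hlow v hv
  have h4 : ε * ‖y i‖ < ε * (2 * r) := by nlinarith
  exact lt_of_mul_lt_mul_left h4 hε.le

end GenericOperators

/-! ### Operators on subspaces of hereditarily indecomposable spaces -/

section Ferenczi

open BoundedContinuousFunction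

universe u

variable {X : Type u} [NormedAddCommGroup X] [NormedSpace ℂ X] [CompleteSpace X]

/-- There is a family of unit vectors of `Y` that approaches every infinite-dimensional closed
subspace of `X`.  It is indexed by the pairs of a finite set of such subspaces and a precision. -/
theorem IsHereditarilyIndecomposable.exists_generic_unit_family
    (hX : IsHereditarilyIndecomposable ℂ X) {Y : Submodule ℂ X} (hY : IsInfDimClosed Y) :
    ∃ (I : Type u) (l : Filter I) (y : I → Y), l.NeBot ∧ (∀ i, ‖y i‖ = 1) ∧
      ∀ W : Submodule ℂ X, IsInfDimClosed W →
        Tendsto (fun i => W.mkQL (y i : X)) l (𝓝 0) := by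
  classical
  have hex : ∀ i : Finset {Z : Submodule ℂ X // IsInfDimClosed Z} × ℕ, ∃ y : Y, ‖y‖ = 1 ∧
      ∀ Z ∈ i.1, ‖Z.1.mkQL (y : X)‖ ≤ 1 / ((i.2 : ℝ) + 1) := by
    intro i
    obtain ⟨W, hWY, hW, hWs⟩ := hX.exists_forall_norm_mkQL_le hY i.1
      (show (0 : ℝ) < 1 / ((i.2 : ℝ) + 1) by positivity)
    obtain ⟨w, hwW, hw1, -⟩ := exists_norm_eq_one_forall_apply_eq_zero hW.2 ∅
    refine ⟨⟨w, hWY hwW⟩, hw1, fun Z hZ => ?_⟩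
    have := hWs Z hZ w hwW
    rwa [hw1, mul_one] at this
  choose y hy1 hy using hex
  refine ⟨_, atTop, y, inferInstance, hy1, fun W hW => ?_⟩
  rw [Metric.tendsto_atTop]
  intro ε hε
  obtain ⟨n, hn⟩ := exists_nat_one_div_lt hε
  refine ⟨({⟨W, hW⟩}, n), fun i hi => ?_⟩
  rw [dist_zero_right]
  refine (hy i ⟨W, hW⟩ (hi.1 (Finset.mem_singleton_self _))).trans_lt (lt_of_le_of_lt ?_ hn)
  have : (n : ℝ) ≤ i.2 := by exact_mod_cast hi.2
  gcongr

/-- Ferenczi's theorem: an operator on a subspace of a complex hereditarily indecomposable Banach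
space differs from a multiple of the inclusion by an operator that is arbitrarily small on
infinite-dimensional subspaces. -/
theorem IsHereditarilyIndecomposable.exists_forall_norm_sub_smul_le
    (hX : IsHereditarilyIndecomposable ℂ X) {Y : Submodule ℂ X} (hY : IsInfDimClosed Y)
    (T : Y →L[ℂ] X) :
    ∃ μ : ℂ, ∀ δ : ℝ, 0 < δ → ∃ W : Submodule ℂ Y, IsInfDimClosed W ∧
      ∀ w ∈ W, ‖(T - μ • Y.subtypeL) w‖ ≤ δ * ‖w‖ := by
  have : CompleteSpace Y := hY.1.completeSpace_coe
  obtain ⟨I, l, u, hl, hu1, hu⟩ := hX.exists_generic_unit_family hY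
  let _ : TopologicalSpace I := ⊥
  have : DiscreteTopology I := ⟨rfl⟩
  have hcQ : CompleteSpace (GenericSpace l Y.subtypeL) := completeSpace_genericSpace l _
  have hcX : CompleteSpace (GenericSpace l (ContinuousLinearMap.id ℂ X)) :=
    completeSpace_genericSpace l _
  let u' : I →ᵇ Y := ofNormedAddCommGroupDiscrete u 1 fun i => (hu1 i).le
  have hu' : u' ∈ genericFamilies l Y.subtypeL := (mem_genericFamilies l).2 hu
  have hnt : Nontrivial (GenericSpace l Y.subtypeL) := by
    refine ⟨genericMk Y.subtypeL ⟨u', hu'⟩, 0, fun h => ?_⟩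
    have h1 : ‖genericMk Y.subtypeL ⟨u', hu'⟩‖ < 1 := by
      simp [h]
    obtain ⟨i, hi⟩ := (eventually_norm_lt_of_norm_genericMk_lt h1).exists
    exact hi.ne (hu1 i)
  have hbij := bijective_genericMap_subtypeL (l := l) hY
  set J := genericMap (l := l) (I := I) Y.subtypeL compLeft_subtypeL_mem_genericFamilies with hJ
  set T' := genericMap (l := l) (I := I) T (hX.compLeft_mem_genericFamilies hY T) with hT'
  let e := ContinuousLinearEquiv.ofBijective J
    (LinearMap.ker_eq_bot.2 hbij.1)
    (LinearMap.range_eq_top.2 hbij.2)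
  have heJ : ∀ q, e q = J q := fun q => rfl
  obtain ⟨μ, hμ⟩ := exists_forall_norm_apply_sub_smul_lt ((e.symm : _ →L[ℂ] _).comp T')
  refine ⟨μ, fun δ hδ => exists_isInfDimClosed_norm_le_of_not_bounded_below hY.2 _ ?_ hδ⟩
  rintro ⟨V, hV, ε, hε, hlow⟩
  obtain ⟨q, hq1, hq⟩ := hμ (ε * (1 / 4) / (‖J‖ + 1)) (by positivity)
  obtain ⟨y, rfl⟩ := genericMk_surjective _ q
  have hJq : J (e.symm (T' (genericMk Y.subtypeL y)) -
      μ • genericMk Y.subtypeL y) =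
      genericMk (ContinuousLinearMap.id ℂ X)
        (⟨T.compLeftContinuousBounded I y.1, hX.compLeft_mem_genericFamilies hY T y.1 y.2⟩ -
          μ • ⟨Y.subtypeL.compLeftContinuousBounded I y.1,
            compLeft_subtypeL_mem_genericFamilies y.1 y.2⟩) := by
    rw [map_sub, map_smul, ← heJ, e.apply_symm_apply, hT', hJ, genericMap_genericMk,
      genericMap_genericMk, map_sub, map_smul]
  have hsmall := J.le_opNorm (e.symm (T' (genericMk Y.subtypeL y)) -
      μ • genericMk Y.subtypeL y)
  rw [hJq] at hsmall
  have hq' : ‖e.symm (T' (genericMk Y.subtypeL y)) -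
      μ • genericMk Y.subtypeL y‖ < ε * (1 / 4) / (‖J‖ + 1) := hq
  rw [lt_div_iff₀ (by positivity)] at hq'
  have hev := eventually_norm_lt_of_norm_genericMk_lt (hsmall.trans_lt
    (show _ < ε * (1 / 4) by
      nlinarith [norm_nonneg (e.symm (T' (genericMk Y.subtypeL y)) -
        μ • genericMk Y.subtypeL y)]))
  have hfin := eventually_norm_lt_of_bounded_below (T - μ • Y.subtypeL) hY.1 hV hε hlow y.2 hev
  have := norm_genericMk_le_of_eventually (by norm_num) (hfin.mono fun i hi => hi.le)
  rw [hq1] at this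
  norm_num at this

end Ferenczi

/-! ### Strict singularity -/

theorem IsSchreierHI.isSchreierStrictlySingular {𝕜 X : Type*} [RCLike 𝕜] [NormedAddCommGroup X]
    [NormedSpace 𝕜 X] [CompleteSpace X] {c : Ordinal.{0} → ℕ+ → Ordinal.{0}} {ξ : Ordinal.{0}}
    (hX : IsSchreierHI 𝕜 X c ξ) {Y : Submodule 𝕜 X} (hY : IsClosed (Y : Set X)) {S : Y →L[𝕜] X}
    (hS : ∀ δ : ℝ, 0 < δ → ∃ W : Submodule 𝕜 Y, IsInfDimClosed W ∧
      ∀ w ∈ W, ‖S w‖ ≤ δ * ‖w‖) :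
    IsSchreierStrictlySingular c ξ S := by
  intro ε hε x hx
  obtain ⟨W, hW, hWS⟩ := hS (ε / 4) (by positivity)
  have hW' := hW.map_subtype hY
  obtain ⟨η, hη0, hη1, hη2⟩ : ∃ η : ℝ, 0 < η ∧ η ≤ 1 / 2 ∧ ‖S‖ * η ≤ ε / 4 := by
    refine ⟨min (1 / 2) (ε / 4 / (‖S‖ + 1)), lt_min (by norm_num) (by positivity),
      min_le_left _ _, ?_⟩
    calc _ ≤ (‖S‖ + 1) * (ε / 4 / (‖S‖ + 1)) := by
          gcongr
          · linarith
          · exact min_le_right _ _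
      _ = ε / 4 := mul_div_cancel₀ _ (by positivity)
  obtain ⟨F, hF, _, ⟨w, hwW, rfl⟩, hw1, hwF⟩ :=
    hX η hη0 _ hW'.1 hW'.2 (fun n => (x n : X)) (hx.coe hY)
  -- A vector of the closed span within `η` of `w` can be taken in the span itself, hence in `Y`.
  rw [closedSpan, Submodule.topologicalClosure_coe, Metric.infDist_closure,
    Metric.infDist_lt_iff ⟨0, Submodule.zero_mem _⟩] at hwF
  obtain ⟨z, hz, hwz⟩ := hwF
  have himg : (fun n => (x n : X)) '' (F : Set ℕ+) = Y.subtype '' (x '' (F : Set ℕ+)) := by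
    rw [Set.image_image]; rfl
  rw [himg, ← Submodule.map_span] at hz
  obtain ⟨z, hz, rfl⟩ := hz
  rw [dist_eq_norm] at hwz
  replace hwz : ‖w - z‖ < η := hwz
  replace hw1 : ‖w‖ = 1 := hw1
  have hz1 : 1 / 2 ≤ ‖z‖ := by
    have := norm_sub_norm_le w z
    linarith
  refine ⟨F, hF, z, Submodule.le_topologicalClosure _ hz, ?_, ?_⟩
  · rintro rfl
    norm_num at hz1
  · have h1 := hWS w hwW
    rw [hw1, mul_one] at h1
    have h2 : ‖S (w - z)‖ ≤ ε / 4 := (S.le_opNorm _).trans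
      ((mul_le_mul_of_nonneg_left hwz.le (norm_nonneg _)).trans hη2)
    calc ‖S z‖ = ‖S w - S (w - z)‖ := by rw [← map_sub, sub_sub_cancel]
      _ ≤ ‖S w‖ + ‖S (w - z)‖ := norm_sub_le _ _
      _ ≤ ε * (1 / 2) := by linarith
      _ ≤ ε * ‖z‖ := by gcongr

theorem corollary6p11 {X : Type*} [NormedAddCommGroup X] [NormedSpace ℂ X] [CompleteSpace X]
    (c : Ordinal.{0} → ℕ+ → Ordinal.{0}) (hc : IsLadderSystem c)
    (ξ : Ordinal.{0}) (hξ₁ : 1 ≤ ξ) (hξ₂ : ξ < Ordinal.omega 1)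
    (hX : IsSchreierHI ℂ X c ξ)
    (Y : Submodule ℂ X) (hYclosed : IsClosed (Y : Set X)) (hY : ¬ FiniteDimensional ℂ Y)
    (T : Y →L[ℂ] X) :
    ∃ (μ : ℂ) (S : Y →L[ℂ] X),
      IsSchreierStrictlySingular c ξ S ∧ T = μ • Y.subtypeL + S := by
  obtain ⟨μ, hμ⟩ :=
    hX.isHereditarilyIndecomposable.exists_forall_norm_sub_smul_le ⟨hYclosed, hY⟩ T
  exact ⟨μ, T - μ • Y.subtypeL, hX.isSchreierStrictlySingular hYclosed hμ,
    (add_sub_cancel _ _).symm⟩
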